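/- Let $A$ be a unital semi-simple commutative complex Banach algebra with character (maximal ideal) space $\mathfrak{M}_A$ and Shilov boundary $\partial A\subseteq\mathfrak{M}_A$ (the smallest closed subset of $\mathfrak{M}_A$ on which every $|\hat f|$, $f\in A$, attains its maximum over $\mathfrak{M}_A$, where $\hat f$ is the Gelfand transform of $f$). For $f\in A$ let $\check f=\hat f|_{\partial A}$, and let $\check A$ be the closure of $\{\check f: f\in A\}$ in $C(\partial A)$. Let $U$ be an (algebra) automorphism of $A$, and let $\varphi$ be the homeomorphism of $\mathfrak{M}_A$ onto itself given by $\varphi(\chi)=\chi\circ U$; it maps $\partial A$ onto itself. Let $w\in A$, let $T=wU$ be the bounded operator $Tf=w\cdot Uf$ on $A$, and for $n\in\mathbb{N}$ put $\check w_n=\check w\,(\check w\circ\varphi)\cdots(\check w\circ\varphi^{n-1})$ on $\partial A$. Assume that every point $t\in\partial A$ is a peak point for $\check A$, i.e. there is $g\in\check A$ with $g(t)=1$ and $|g(t')|<1$ for all $t'\in\partial A\setminus\{t\}$. Suppose there are $\lambda\in\mathbb{C}$ and a point $s\in\partial A$ that is not $\varphi$-periodic (i.e. $\varphi^n(s)\ne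 s$ for all $n\ge 1$) such that $$|\check w_n(s)|\le|\lambda|^n\quad\text{and}\quad|\check w_n(\varphi^{-n}(s))|\ge|\lambda|^n\qquad\text{for all } n\in\mathbb{N}.$$ Then $\lambda\mathbb{T}\subseteq\sigma(T)$, where $\mathbb{T}=\{z\in\mathbb{C}:|z|=1\}$ and $\sigma(T)$ is the spectrum of $T$ as a bounded operator on $A$. -/

import Mathlib

open scoped Pointwise

open WeakDual

namespace WeightedAut

noncomputable section

/-- A closed boundary of the commutative Banach algebra `A`: a closed set of characters on which
the modulus of every Gelfand transform attains its maximum over the whole character space. -/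
def IsClosedBoundary (A : Type*) [NormedCommRing A] [NormedAlgebra ℂ A]
    (F : Set (characterSpace ℂ A)) : Prop :=
  IsClosed F ∧ ∀ (f : A) (χ : characterSpace ℂ A), ∃ ψ ∈ F, ‖χ f‖ ≤ ‖ψ f‖

/-- The Shilov boundary `∂A`: the smallest closed boundary, that is, the intersection of all
closed boundaries. -/
def shilovBoundary (A : Type*) [NormedCommRing A] [NormedAlgebra ℂ A] :
    Set (characterSpace ℂ A) :=
  ⋂₀ {F | IsClosedBoundary A F}

/-- `f ↦ f̌`, the Gelfand transform restricted to the Shilov boundary. -/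
def check {A : Type*} [NormedCommRing A] [NormedAlgebra ℂ A] (f : A) :
    C(shilovBoundary A, ℂ) :=
  (WeakDual.gelfandTransform ℂ A f).restrict (shilovBoundary A)

/-- `Ǎ`, the closure of `{f̌ : f ∈ A}` in `C(∂A)` (uniform convergence, as `∂A` is compact). -/
def checkAlgebra (A : Type*) [NormedCommRing A] [NormedAlgebra ℂ A] :
    Set C(shilovBoundary A, ℂ) :=
  closure (Set.range (check : A → C(shilovBoundary A, ℂ)))

/-- `x` is a peak point for the set `B` of continuous functions on `X`. -/
def IsPeakPoint {X : Type*} [TopologicalSpace X] (B : Set C(X, ℂ)) (x : X) : Prop :=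
  ∃ g ∈ B, g x = 1 ∧ ∀ y, y ≠ x → ‖g y‖ < 1

section

variable {A : Type*} [NormedCommRing A] [NormedAlgebra ℂ A] [CompleteSpace A]

/-- The map `χ ↦ χ ∘ U` on characters. -/
def compChar (U : A ≃ₐ[ℂ] A) (χ : characterSpace ℂ A) : characterSpace ℂ A :=
  CharacterSpace.equivAlgHom.symm ((CharacterSpace.equivAlgHom χ).comp (U : A →ₐ[ℂ] A))

@[simp]
theorem compChar_apply (U : A ≃ₐ[ℂ] A) (χ : characterSpace ℂ A) (f : A) :
    compChar U χ f = χ (U f) := rfl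

theorem continuous_compChar (U : A ≃ₐ[ℂ] A) : Continuous (compChar U) := by
  refine Continuous.subtype_mk (WeakDual.continuous_of_continuous_eval fun f => ?_) _
  exact (WeakDual.eval_continuous (U f)).comp continuous_subtype_val

/-- The homeomorphism `φ` of the character space induced by the automorphism `U`. -/
def charHomeo (U : A ≃ₐ[ℂ] A) : characterSpace ℂ A ≃ₜ characterSpace ℂ A where
  toFun := compChar U
  invFun := compChar U.symm
  left_inv χ := by
    apply CharacterSpace.ext
    intro f
    simp
  right_inv χ := by
    apply CharacterSpace.ext
    intro f
    simp
  continuous_toFun := continuous_compChar U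
  continuous_invFun := continuous_compChar U.symm

@[simp]
theorem charHomeo_apply (U : A ≃ₐ[ℂ] A) (χ : characterSpace ℂ A) (f : A) :
    charHomeo U χ f = χ (U f) := rfl

@[simp]
theorem charHomeo_symm_apply (U : A ≃ₐ[ℂ] A) (χ : characterSpace ℂ A) (f : A) :
    (charHomeo U).symm χ f = χ (U.symm f) := rfl

theorem isClosedBoundary_preimage (U : A ≃ₐ[ℂ] A) {F : Set (characterSpace ℂ A)}
    (hF : IsClosedBoundary A F) : IsClosedBoundary A (charHomeo U ⁻¹' F) := by
  refine ⟨hF.1.preimage (charHomeo U).continuous, fun f χ => ?_⟩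
  obtain ⟨ψ, hψ, h⟩ := hF.2 (U.symm f) (charHomeo U χ)
  refine ⟨(charHomeo U).symm ψ, by simpa using hψ, ?_⟩
  simpa using h

theorem charHomeo_mem (U : A ≃ₐ[ℂ] A) {χ : characterSpace ℂ A}
    (h : χ ∈ shilovBoundary A) : charHomeo U χ ∈ shilovBoundary A :=
  fun _ hF => h _ (isClosedBoundary_preimage U hF)

theorem mem_shilovBoundary_iff (U : A ≃ₐ[ℂ] A) (χ : characterSpace ℂ A) :
    χ ∈ shilovBoundary A ↔ charHomeo U χ ∈ shilovBoundary A := by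
  refine ⟨charHomeo_mem U, fun h => ?_⟩
  have h2 := charHomeo_mem U.symm h
  have h3 : charHomeo U.symm (charHomeo U χ) = χ := (charHomeo U).left_inv χ
  rwa [h3] at h2

/-- The homeomorphism `φ` of the Shilov boundary onto itself induced by `U`. -/
def boundaryHomeo (U : A ≃ₐ[ℂ] A) : shilovBoundary A ≃ₜ shilovBoundary A :=
  (charHomeo U).subtype (mem_shilovBoundary_iff U)

@[simp]
theorem boundaryHomeo_coe (U : A ≃ₐ[ℂ] A) (t : shilovBoundary A) (f : A) :
    (boundaryHomeo U t : characterSpace ℂ A) f = (t : characterSpace ℂ A) (U f) := rfl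

/-- `w̌_n = w̌ (w̌ ∘ φ) ⋯ (w̌ ∘ φ^(n-1))` on the Shilov boundary. -/
def cocycle (U : A ≃ₐ[ℂ] A) (w : A) (n : ℕ) (t : shilovBoundary A) : ℂ :=
  ∏ i ∈ Finset.range n, check w ((boundaryHomeo U)^[i] t)

/-- An algebra automorphism of a semi-simple commutative Banach algebra is continuous. -/
theorem continuous_of_jacobson_eq_bot (hA : Ring.jacobson A = ⊥) (U : A ≃ₐ[ℂ] A) :
    Continuous U := by
  have sep : ∀ a : A, (∀ χ : characterSpace ℂ A, χ a = 0) → a = 0 := by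
    intro a ha
    have : a ∈ Ring.jacobson A := by
      rw [Ring.jacobson_eq_sInf_isMaximal]
      refine (Submodule.mem_sInf).2 fun (I : Ideal A) (hI' : I.IsMaximal) => ?_
      by_contra hn
      obtain ⟨b, i, hi, hb⟩ := hI'.exists_inv hn
      obtain ⟨χ, hχ⟩ := WeakDual.CharacterSpace.exists_apply_eq_zero (a := i)
        (fun hu => hI'.ne_top (Ideal.eq_top_of_isUnit_mem I hi hu))
      have := congrArg χ hb
      simp [ha, hχ] at this
    rw [hA] at this
    simpa using this
  refine LinearMap.continuous_of_seq_closed_graph (g := U.toLinearMap) fun u x y hu hy => ?_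
  refine sub_eq_zero.1 (sep _ fun χ => ?_)
  have h1 : Filter.Tendsto (fun n => χ (U (u n))) Filter.atTop (nhds (χ y)) :=
    ((map_continuous χ).tendsto y).comp hy
  have h2 : Filter.Tendsto (fun n => χ (U (u n))) Filter.atTop (nhds (χ (U x))) :=
    ((map_continuous (compChar U χ)).tendsto x).comp hu
  have := tendsto_nhds_unique h1 h2
  simp [this]

/-- The bounded operator `T = wU`, `T f = w · U f`, on the semi-simple algebra `A`. -/
def weightedOperator (hA : Ring.jacobson A = ⊥) (U : A ≃ₐ[ℂ] A) (w : A) : A →L[ℂ] A where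
  toLinearMap := LinearMap.mulLeft ℂ w ∘ₗ U.toLinearMap
  cont := continuous_const.mul (continuous_of_jacobson_eq_bot hA U)

@[simp]
theorem weightedOperator_apply (hA : Ring.jacobson A = ⊥) (U : A ≃ₐ[ℂ] A) (w f : A) :
    weightedOperator hA U w f = w * U f := rfl

end

end

end WeightedAut

namespace WeightedAut

/-! Suppose `ν` with `‖ν‖ = ‖λ‖ ≠ 0` lies in the resolvent set, and put `μ = ν * exp (-z)` with `z`
near `0`. Take `F k` in `A` close to the `k`-th power of a function peaking at `s`, and let `h k z`
be the value at `s` of `(μ - T)⁻¹ (F k)`, which is analytic in `z`. Evaluated along the orbit of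
`s`, the resolvent equation is a first-order recursion. For `Re z < 0` the bound on `w̌_n(s)` lets
it be solved along the forward orbit, for `Re z > 0` the bound on `w̌_n(φ⁻ⁿ(s))` along the backward
one. As `s` is not periodic, it occurs only as the initial point of the forward series, so `h k →
μ⁻¹` on the left and `h k → 0` on the right.

The norms of `F k` in `A` need not be bounded, so resolvent bounds do not exclude such a jump. Sup
norms on `∂A` are bounded, and the geometric series give `‖h k z‖ ≤ C / |Re z|` uniformly in `k`.
Multiplication by `z ^ 2 + r ^ 2`, which vanishes where the circle `|z| = r` meets the imaginary
axis, removes the singularity of this bound. The maximum principle and a Schwarz estimate then make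
these products equi-Lipschitz near `0`: a contradiction. -/

/-! ### Analytic estimates across the imaginary axis -/

open Filter Topology Metric in
theorem hasSum_of_telescoping {u v : ℕ → ℂ} (hu : Tendsto u atTop (𝓝 0)) (hv : Summable v)
    (huv : ∀ n, u n - u (n + 1) = v n) : HasSum v (u 0) := by
  have h1 : Tendsto (fun n => ∑ i ∈ Finset.range n, v i) atTop (𝓝 (u 0)) := by
    have h2 : ∀ n, ∑ i ∈ Finset.range n, v i = u 0 - u n := fun n => by
      simp_rw [← huv, Finset.sum_range_sub']
    simp_rw [h2]
    simpa using tendsto_const_nhds.sub hu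
  rw [← tendsto_nhds_unique hv.hasSum.tendsto_sum_nat h1]
  exact hv.hasSum

/-- A rearrangement of `x + 1 ≤ exp x`; it turns the sum of a geometric series of ratio `exp (-x)`
into a bound of order `1 / x`. -/
theorem inv_one_sub_exp_neg_mul_le {x : ℝ} (hx : 0 < x) :
    (1 - Real.exp (-x))⁻¹ * x ≤ Real.exp x := by
  have h1 : Real.exp (-x) < 1 := by simpa using hx
  rw [inv_mul_le_iff₀ (by linarith), sub_mul, ← Real.exp_add]
  have := Real.add_one_le_exp x
  simp
  linarith

open Metric in
/-- An analytic function growing at most like `1 / |Re z|` on a circle is controlled inside. -/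
theorem norm_sq_add_sq_mul_le {h : ℂ → ℂ} {R r C : ℝ} (hr : 0 < r) (hrR : r < R)
    (hd : DifferentiableOn ℂ h (ball 0 R)) (hb : ∀ z ∈ ball (0 : ℂ) R, ‖h z‖ * |z.re| ≤ C)
    {z : ℂ} (hz : z ∈ ball (0 : ℂ) r) : ‖(z ^ 2 + r ^ 2) * h z‖ ≤ 2 * r * C := by
  have hd' : DifferentiableOn ℂ (fun z : ℂ => (z ^ 2 + r ^ 2) * h z) (ball 0 R) :=
    DifferentiableOn.mul (by fun_prop) hd
  have hsub : closedBall (0 : ℂ) r ⊆ ball 0 R := closedBall_subset_ball hrR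
  refine Complex.norm_le_of_forall_mem_frontier_norm_le (U := ball (0 : ℂ) r) isBounded_ball
    (DifferentiableOn.diffContOnCl (hd'.mono ?_)) ?_ (subset_closure hz)
  · exact closure_ball_subset_closedBall.trans hsub
  · intro z hz
    rw [frontier_ball _ hr.ne', mem_sphere_zero_iff_norm] at hz
    -- On the circle `r ^ 2 = z * conj z`, so the factor `Re z` cancels the singularity of the
    -- bound.
    have h1 : z ^ 2 + (r : ℂ) ^ 2 = z * ((2 * z.re : ℝ) : ℂ) := by
      have h2 : (r : ℂ) ^ 2 = z * (starRingEnd ℂ) z := by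
        rw [Complex.mul_conj, Complex.normSq_eq_norm_sq, hz]; simp
      rw [h2, ← Complex.add_conj]; ring
    rw [h1, norm_mul, norm_mul, hz, Complex.norm_real, Real.norm_eq_abs, abs_mul, abs_two]
    have := hb z (hsub (by simp [hz]))
    nlinarith

open Filter Topology Metric in
/-- Analytic functions with a common bound `C / |Re z|` cannot have limits which jump across the
imaginary axis. -/
theorem eq_zero_of_tendsto_of_norm_mul_abs_re_le {h : ℕ → ℂ → ℂ} {R C : ℝ} (hR : 0 < R)
    (hd : ∀ k, DifferentiableOn ℂ (h k) (ball 0 R))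
    (hb : ∀ k, ∀ z ∈ ball (0 : ℂ) R, ‖h k z‖ * |z.re| ≤ C) {a : ℂ}
    (hleft : ∀ x : ℝ, 0 < x → x < R →
      Tendsto (fun k => h k (-x)) atTop (𝓝 (Complex.exp (-x) * a)))
    (hright : ∀ x : ℝ, 0 < x → x < R → Tendsto (fun k => h k x) atTop (𝓝 0)) : a = 0 := by
  have hC : 0 ≤ C := by simpa using hb 0 0 (by simpa using hR)
  obtain ⟨r, hr, hrR⟩ := exists_between hR
  -- Two values of size at most `2 * r * C` differ by at most `4 * r * C`; the `1` keeps `D`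
  -- positive.
  set D : ℝ := 4 * r * C + 1 with hD
  have hD0 : 0 < D := by positivity
  -- For `x < r / 4` the disc of radius `r / 2` about `-x` lies in `ball 0 r` and contains `x`; the
  -- Schwarz lemma there bounds the jump by a multiple of `x`, uniformly in `k`.
  have key : ∀ x : ℝ, 0 < x → x < r / 4 →
      r ^ 2 * Real.exp (-r) * ‖a‖ ≤ D / (r / 2) * (2 * x) := by
    intro x hx hxr
    have hxR : x < R := by linarith
    have hl : Tendsto (fun k => (((-x : ℂ)) ^ 2 + r ^ 2) * h k (-x)) atTop
        (𝓝 (((-x : ℂ) ^ 2 + r ^ 2) * (Complex.exp (-x) * a))) :=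
      (hleft x hx hxR).const_mul _
    have hr' : Tendsto (fun k => ((x : ℂ) ^ 2 + r ^ 2) * h k x) atTop
        (𝓝 (((x : ℂ) ^ 2 + r ^ 2) * 0)) := (hright x hx hxR).const_mul _
    have hlim := hr'.dist hl
    have hle : ∀ k, dist (((x : ℂ) ^ 2 + r ^ 2) * h k x) ((((-x : ℂ)) ^ 2 + r ^ 2) * h k (-x))
        ≤ D / (r / 2) * (2 * x) := by
      intro k
      have hsub : ball (-x : ℂ) (r / 2) ⊆ ball 0 r := by
        refine ball_subset_ball' ?_
        simp [abs_of_pos hx]; linarith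
      have hmem : (-x : ℂ) ∈ ball (0 : ℂ) r := hsub (mem_ball_self (by positivity))
      have hd' : DifferentiableOn ℂ (fun z : ℂ => (z ^ 2 + r ^ 2) * h k z)
          (ball (-x : ℂ) (r / 2)) :=
        DifferentiableOn.mul (by fun_prop)
          ((hd k).mono (hsub.trans (ball_subset_ball hrR.le)))
      have hdist : dist (x : ℂ) (-x) = 2 * x := by
        rw [dist_eq_norm]
        have : (x : ℂ) - -x = ((2 * x : ℝ) : ℂ) := by push_cast; ring
        rw [this, Complex.norm_real, Real.norm_of_nonneg (by positivity)]
      have := Complex.dist_le_div_mul_dist_of_mapsTo_ball (R₂ := D) hd' ?_ (z := (x : ℂ)) ?_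
      · rwa [hdist] at this
      · intro z hz
        rw [mem_closedBall, dist_eq_norm]
        have h1 := norm_sq_add_sq_mul_le hr hrR (hd k) (hb k) (hsub hz)
        have h2 := norm_sq_add_sq_mul_le hr hrR (hd k) (hb k) hmem
        have h3 := norm_sub_le ((z ^ 2 + r ^ 2) * h k z) (((-x : ℂ) ^ 2 + r ^ 2) * h k (-x))
        simp only
        linarith
      · rw [mem_ball, hdist]; linarith
    have h4 := le_of_tendsto hlim (Eventually.of_forall hle)
    refine le_trans ?_ h4
    rw [mul_zero, dist_zero_left, norm_mul, norm_mul, ← mul_assoc]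
    have h5 : ((-x : ℂ) ^ 2 + r ^ 2) = ((x ^ 2 + r ^ 2 : ℝ) : ℂ) := by push_cast; ring
    have h6 : Complex.exp (-x) = ((Real.exp (-x) : ℝ) : ℂ) := by push_cast; rfl
    rw [h5, h6, Complex.norm_real, Complex.norm_real, Real.norm_of_nonneg (by positivity),
      Real.norm_of_nonneg (Real.exp_pos _).le]
    have h7 : Real.exp (-r) ≤ Real.exp (-x) := Real.exp_le_exp.2 (by linarith)
    gcongr
    nlinarith
  have hlim : Tendsto (fun x : ℝ => D / (r / 2) * (2 * x)) (𝓝[>] 0) (𝓝 0) := by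
    have : Continuous fun x : ℝ => D / (r / 2) * (2 * x) := by fun_prop
    simpa using (this.tendsto 0).mono_left nhdsWithin_le_nhds
  have h8 : r ^ 2 * Real.exp (-r) * ‖a‖ ≤ 0 := by
    refine ge_of_tendsto hlim ?_
    filter_upwards [Ioo_mem_nhdsGT (show (0 : ℝ) < r / 4 by positivity)] with x hx
    exact key x hx.1 hx.2
  by_contra ha
  have : 0 < r ^ 2 * Real.exp (-r) * ‖a‖ := by
    have := norm_pos_iff.2 ha
    positivity
  linarith

/-! ### Compactness of `∂A` and peaking sequences -/

theorem isClosed_shilovBoundary (A : Type*) [NormedCommRing A] [NormedAlgebra ℂ A] :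
    IsClosed (shilovBoundary A) :=
  isClosed_sInter fun _ hF => hF.1

instance compactSpace_shilovBoundary (A : Type*) [NormedCommRing A] [NormedAlgebra ℂ A]
    [CompleteSpace A] : CompactSpace (shilovBoundary A) :=
  isCompact_iff_compactSpace.1 (isClosed_shilovBoundary A).isCompact

theorem check_eq {A : Type*} [NormedCommRing A] [NormedAlgebra ℂ A] (f : A)
    (t : shilovBoundary A) : check f t = (t : characterSpace ℂ A) f := rfl

section

variable {A : Type*} [NormedCommRing A] [NormedAlgebra ℂ A] [CompleteSpace A]

theorem pow_mem_checkAlgebra {g : C(shilovBoundary A, ℂ)} (hg : g ∈ checkAlgebra A) (k : ℕ) :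
    g ^ k ∈ checkAlgebra A := by
  refine map_mem_closure (f := fun g : C(shilovBoundary A, ℂ) => g ^ k) (continuous_pow k) hg ?_
  rintro _ ⟨f, rfl⟩
  exact ⟨f ^ k, by ext t; simp [check_eq]⟩

open Filter Topology in
/-- Approximate powers of a peaking function by Gelfand transforms. -/
theorem exists_seq_tendsto_of_isPeakPoint {s : shilovBoundary A}
    (hs : IsPeakPoint (checkAlgebra A) s) :
    ∃ F : ℕ → A, (∀ k t, ‖check (F k) t‖ ≤ 2) ∧
      Tendsto (fun k => check (F k) s) atTop (𝓝 1) ∧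
      ∀ t, t ≠ s → Tendsto (fun k => check (F k) t) atTop (𝓝 0) := by
  obtain ⟨g, hg, hgs, hlt⟩ := hs
  have h1 : ∀ k : ℕ, ∃ f : A, ‖check f - g ^ k‖ < 1 / ((k : ℝ) + 1) := fun k => by
    obtain ⟨_, ⟨f, rfl⟩, hf⟩ :=
      Metric.mem_closure_iff.1 (pow_mem_checkAlgebra hg k) (1 / ((k : ℝ) + 1)) (by positivity)
    exact ⟨f, by rwa [dist_comm, dist_eq_norm] at hf⟩
  choose F hF using h1
  have h2 : ∀ k t, ‖check (F k) t - g t ^ k‖ ≤ 1 / ((k : ℝ) + 1) := fun k t =>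
    ((check (F k) - g ^ k).norm_coe_le_norm t).trans (hF k).le
  have h3 : ∀ t, Tendsto (fun k => check (F k) t - g t ^ k) atTop (𝓝 0) := fun t =>
    squeeze_zero_norm (fun k => h2 k t) tendsto_one_div_add_atTop_nhds_zero_nat
  refine ⟨F, fun k t => ?_, ?_, fun t ht => ?_⟩
  · have hg1 : ‖g t‖ ≤ 1 := by
      by_cases ht : t = s
      · simp [ht, hgs]
      · exact (hlt t ht).le
    have h4 : 1 / ((k : ℝ) + 1) ≤ 1 := by
      rw [div_le_one (by positivity)]; simp
    have h5 : ‖g t ^ k‖ ≤ 1 := by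
      rw [norm_pow]; exact pow_le_one₀ (norm_nonneg _) hg1
    have h6 := norm_sub_norm_le (check (F k) t) (g t ^ k)
    linarith [h2 k t]
  · simpa [hgs] using (h3 s).add_const 1
  · simpa using (h3 t).add (tendsto_pow_atTop_nhds_zero_of_norm_lt_one (hlt t ht))

/-! ### Orbit series for solutions of the resolvent equation -/

variable (U : A ≃ₐ[ℂ] A) (w : A)

theorem cocycle_succ (n : ℕ) (t : shilovBoundary A) :
    cocycle U w (n + 1) t = cocycle U w n t * check w ((boundaryHomeo U)^[n] t) :=
  Finset.prod_range_succ _ _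

theorem cocycle_succ' (n : ℕ) (t : shilovBoundary A) :
    cocycle U w (n + 1) t = cocycle U w n (boundaryHomeo U t) * check w t := by
  simp [cocycle, Finset.prod_range_succ']

theorem cocycle_zero (t : shilovBoundary A) : cocycle U w 0 t = 1 := by
  simp [cocycle]

theorem iterate_symm_succ (n : ℕ) (s : shilovBoundary A) :
    boundaryHomeo U ((boundaryHomeo U).symm^[n + 1] s) = (boundaryHomeo U).symm^[n] s := by
  rw [Function.iterate_succ_apply']; simp

theorem check_mul_boundaryHomeo (hA : Ring.jacobson A = ⊥) {μ : ℂ} {f g : A}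
    (hfg : μ • g - weightedOperator hA U w g = f) (t : shilovBoundary A) :
    check w t * check g (boundaryHomeo U t) = μ * check g t - check f t := by
  subst hfg
  simp [check_eq]

variable {U w}

/-- Iterate `ǧ = (f̌ + w̌ (ǧ ∘ φ)) / μ` from `s`; the remainder is at most `‖ǧ‖ * q ^ n`. The term
bounds involve `f` only through its values on the orbit, hence will be uniform over the peaking
sequence. -/
theorem hasSum_forward (hA : Ring.jacobson A = ⊥) {μ : ℂ} {f g : A}
    (hfg : μ • g - weightedOperator hA U w g = f) {s : shilovBoundary A} {l q : ℝ} (hl : 0 < l)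
    (hq : 0 < q) (hq1 : q < 1) (hμ : ‖μ‖ = l / q) (hle : ∀ n, ‖cocycle U w n s‖ ≤ l ^ n) :
    HasSum (fun n => cocycle U w n s * check f ((boundaryHomeo U)^[n] s) / μ ^ (n + 1))
      (check g s) ∧
    ∀ n c, ‖check f ((boundaryHomeo U)^[n] s)‖ ≤ c →
      ‖cocycle U w n s * check f ((boundaryHomeo U)^[n] s) / μ ^ (n + 1)‖ ≤ c / l * q ^ n := by
  have hμ0 : μ ≠ 0 := by
    rw [← norm_pos_iff, hμ]; positivity
  have hb : ∀ n c, ‖check f ((boundaryHomeo U)^[n] s)‖ ≤ c →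
      ‖cocycle U w n s * check f ((boundaryHomeo U)^[n] s) / μ ^ (n + 1)‖ ≤ c / l * q ^ n := by
    intro n c hc
    have hc0 : 0 ≤ c := (norm_nonneg _).trans hc
    rw [norm_div, norm_mul, norm_pow, hμ]
    calc _ ≤ l ^ n * c / (l / q) ^ (n + 1) := by
          gcongr; exact hle n
      _ = c / l * q ^ n * q := by rw [div_pow]; field_simp; ring
      _ ≤ c / l * q ^ n := mul_le_of_le_one_right (by positivity) hq1.le
  have hgeo : Summable fun n => ‖check f‖ / l * q ^ n :=
    (summable_geometric_of_lt_one hq.le hq1).mul_left _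
  refine ⟨?_, hb⟩
  have := hasSum_of_telescoping
    (u := fun n => cocycle U w n s * check g ((boundaryHomeo U)^[n] s) / μ ^ n)
    (v := fun n => cocycle U w n s * check f ((boundaryHomeo U)^[n] s) / μ ^ (n + 1)) ?_
    (.of_norm_bounded hgeo fun n => hb n _ ((check f).norm_coe_le_norm _)) fun n => ?_
  · simpa [cocycle_zero] using this
  · have h0 : Filter.Tendsto (fun n => ‖check g‖ * q ^ n) Filter.atTop (nhds 0) := by
      simpa using (tendsto_pow_atTop_nhds_zero_of_lt_one hq.le hq1).const_mul ‖check g‖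
    refine squeeze_zero_norm (fun n => ?_) h0
    rw [norm_div, norm_mul, norm_pow, hμ]
    calc _ ≤ l ^ n * ‖check g‖ / (l / q) ^ n := by
          gcongr
          · exact hle n
          · exact (check g).norm_coe_le_norm _
      _ = _ := by rw [div_pow]; field_simp
  · have h := check_mul_boundaryHomeo U w hA hfg ((boundaryHomeo U)^[n] s)
    rw [cocycle_succ, Function.iterate_succ_apply', mul_assoc, h]
    field_simp
    ring

/-- The same recursion solved for `ǧ ∘ φ`, dividing by `w̌`, which the lower bound keeps nonzero on
the backward orbit. The series starts at `φ⁻¹(s)`, so `f̌(s)` does not enter. -/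
theorem hasSum_backward (hA : Ring.jacobson A = ⊥) {μ : ℂ} {f g : A}
    (hfg : μ • g - weightedOperator hA U w g = f) {s : shilovBoundary A} {l q : ℝ} (hl : 0 < l)
    (hq : 0 < q) (hq1 : q < 1) (hμ : ‖μ‖ = l * q)
    (hge : ∀ n, l ^ n ≤ ‖cocycle U w n ((boundaryHomeo U).symm^[n] s)‖) :
    HasSum (fun n => -(μ ^ n * check f ((boundaryHomeo U).symm^[n + 1] s) /
      cocycle U w (n + 1) ((boundaryHomeo U).symm^[n + 1] s))) (check g s) ∧
    ∀ n c, ‖check f ((boundaryHomeo U).symm^[n + 1] s)‖ ≤ c →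
      ‖-(μ ^ n * check f ((boundaryHomeo U).symm^[n + 1] s) /
      cocycle U w (n + 1) ((boundaryHomeo U).symm^[n + 1] s))‖ ≤ c / l * q ^ n := by
  have hw : ∀ n, cocycle U w n ((boundaryHomeo U).symm^[n] s) ≠ 0 := fun n =>
    norm_pos_iff.1 ((pow_pos hl n).trans_le (hge n))
  have hb : ∀ n c, ‖check f ((boundaryHomeo U).symm^[n + 1] s)‖ ≤ c →
      ‖-(μ ^ n * check f ((boundaryHomeo U).symm^[n + 1] s) /
      cocycle U w (n + 1) ((boundaryHomeo U).symm^[n + 1] s))‖ ≤ c / l * q ^ n := by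
    intro n c hc
    have hc0 : 0 ≤ c := (norm_nonneg _).trans hc
    rw [norm_neg, norm_div, norm_mul, norm_pow, hμ]
    calc _ ≤ (l * q) ^ n * c / l ^ (n + 1) := by
          gcongr; exact hge (n + 1)
      _ = c / l * q ^ n := by rw [mul_pow]; field_simp; ring
  have hgeo : Summable fun n => ‖check f‖ / l * q ^ n :=
    (summable_geometric_of_lt_one hq.le hq1).mul_left _
  refine ⟨?_, hb⟩
  have := hasSum_of_telescoping
    (u := fun n => μ ^ n * check g ((boundaryHomeo U).symm^[n] s) /
      cocycle U w n ((boundaryHomeo U).symm^[n] s)) ?_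
    (.of_norm_bounded hgeo fun n => hb n _ ((check f).norm_coe_le_norm _)) fun n => ?_
  · simpa [cocycle_zero] using this
  · have h0 : Filter.Tendsto (fun n => ‖check g‖ * q ^ n) Filter.atTop (nhds 0) := by
      simpa using (tendsto_pow_atTop_nhds_zero_of_lt_one hq.le hq1).const_mul ‖check g‖
    refine squeeze_zero_norm (fun n => ?_) h0
    rw [norm_div, norm_mul, norm_pow, hμ]
    calc _ ≤ (l * q) ^ n * ‖check g‖ / l ^ n := by
          gcongr
          · exact (check g).norm_coe_le_norm _
          · exact hge n
      _ = _ := by rw [mul_pow]; field_simp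
  · have h := check_mul_boundaryHomeo U w hA hfg ((boundaryHomeo U).symm^[n + 1] s)
    have hw1 := hw (n + 1)
    have hw2 := hw n
    rw [cocycle_succ', iterate_symm_succ] at hw1 ⊢
    rw [iterate_symm_succ] at h
    have hw3 := right_ne_zero_of_mul hw1
    rw [pow_succ]
    field_simp
    linear_combination μ ^ n * h

/-! ### Spectrum of the weighted operator -/

open Filter Topology Metric in
theorem mem_spectrum_weightedOperator (hA : Ring.jacobson A = ⊥) {s : shilovBoundary A}
    (hpeak : IsPeakPoint (checkAlgebra A) s)
    (hs : s ∉ Function.periodicPts (boundaryHomeo U)) {ν : ℂ} (hν : ν ≠ 0)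
    (hle : ∀ n, ‖cocycle U w n s‖ ≤ ‖ν‖ ^ n)
    (hge : ∀ n, ‖ν‖ ^ n ≤ ‖cocycle U w n ((boundaryHomeo U).symm^[n] s)‖) :
    ν ∈ spectrum ℂ (weightedOperator hA U w) := by
  by_contra hmem
  have hl : 0 < ‖ν‖ := norm_pos_iff.2 hν
  set T := weightedOperator hA U w with hT
  have hforw : ∀ n, (boundaryHomeo U)^[n + 1] s ≠ s := fun n hn =>
    hs (Function.mk_mem_periodicPts n.succ_pos hn)
  have hback : ∀ n, (boundaryHomeo U).symm^[n + 1] s ≠ s := fun n hn => by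
    refine hforw n ?_
    nth_rw 1 [← hn]
    exact (Function.LeftInverse.iterate (boundaryHomeo U).apply_symm_apply (n + 1)) s
  obtain ⟨F, hF2, hFs, hF0⟩ := exists_seq_tendsto_of_isPeakPoint hpeak
  -- This carries the imaginary axis into the circle `|μ| = ‖ν‖`, the left half-plane outside it and
  -- the right one inside.
  set μ : ℂ → ℂ := fun z => ν * Complex.exp (-z) with hμ
  have hμc : Continuous μ := by fun_prop
  have hopen : IsOpen (μ ⁻¹' resolventSet ℂ T) := (spectrum.isOpen_resolventSet T).preimage hμc
  obtain ⟨R, hR, hball⟩ := Metric.isOpen_iff.1 hopen 0 (by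
    simpa [hμ, spectrum.mem_resolventSet_iff] using spectrum.notMem_iff.1 hmem)
  have hnorm : ∀ z, ‖μ z‖ = ‖ν‖ * Real.exp (-z.re) := fun z => by
    simp [hμ, Complex.norm_exp]
  set G : ℕ → ℂ → A := fun k z => resolvent T (μ z) (F k) with hG
  have hres : ∀ k, ∀ z ∈ ball (0 : ℂ) R, μ z • G k z - T (G k z) = F k := fun k z hz => by
    have h1 : (algebraMap ℂ (A →L[ℂ] A) (μ z) - T) * resolvent T (μ z) = 1 :=
      Ring.mul_inverse_cancel _ (hball hz)
    simpa [hG, Algebra.algebraMap_eq_smul_one] using congrArg (fun S : A →L[ℂ] A => S (F k)) h1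
  have hneg : ∀ z ∈ ball (0 : ℂ) R, z.re < 0 → ∀ k, _ := fun z hz hre k =>
    hasSum_forward hA (hres k z hz) (q := Real.exp z.re) hl (Real.exp_pos _)
      (Real.exp_lt_one_iff.2 hre) (by rw [hnorm, Real.exp_neg, div_eq_mul_inv]) hle
  have hpos : ∀ z ∈ ball (0 : ℂ) R, 0 < z.re → ∀ k, _ := fun z hz hre k =>
    hasSum_backward hA (hres k z hz) (q := Real.exp (-z.re)) hl (Real.exp_pos _)
      (Real.exp_lt_one_iff.2 (by linarith)) (hnorm z) hge
  have hsum : ∀ x : ℝ, 0 < x → HasSum (fun n : ℕ => 2 / ‖ν‖ * Real.exp (-x) ^ n)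
      (2 / ‖ν‖ * (1 - Real.exp (-x))⁻¹) := fun x hx =>
    (hasSum_geometric_of_lt_one (Real.exp_pos _).le (Real.exp_lt_one_iff.2 (by linarith))).mul_left _
  have hbound : ∀ x : ℝ, 0 < x → x < R → ∀ y : ℝ, y ≤ 2 / ‖ν‖ * (1 - Real.exp (-x))⁻¹ →
      y * x ≤ 2 / ‖ν‖ * Real.exp R := fun x hx hxR y hy => by
    calc y * x ≤ 2 / ‖ν‖ * (1 - Real.exp (-x))⁻¹ * x := by gcongr
      _ = 2 / ‖ν‖ * ((1 - Real.exp (-x))⁻¹ * x) := by ring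
      _ ≤ 2 / ‖ν‖ * Real.exp R := by
        gcongr
        exact (inv_one_sub_exp_neg_mul_le hx).trans (Real.exp_le_exp.2 hxR.le)
  refine inv_ne_zero hν (eq_zero_of_tendsto_of_norm_mul_abs_re_le
    (h := fun k z => check (G k z) s) (C := 2 / ‖ν‖ * Real.exp R) hR ?_ ?_ ?_ ?_)
  · intro k z hz
    have h1 : DifferentiableAt ℂ (fun z => resolvent T (μ z)) z :=
      (spectrum.hasDerivAt_resolvent_const_left (hball hz)).differentiableAt.comp z (by fun_prop)
    have h2 : DifferentiableAt ℂ (fun z => G k z) z := h1.clm_apply (differentiableAt_const _)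
    exact ((WeakDual.CharacterSpace.toCLM (s : characterSpace ℂ A)).differentiableAt.comp
      z h2).differentiableWithinAt
  · intro k z hz
    have hzR : |z.re| < R :=
      (Complex.abs_re_le_norm z).trans_lt (by simpa using hz)
    rcases lt_trichotomy z.re 0 with h | h | h
    · rw [abs_of_neg h] at hzR ⊢
      refine hbound _ (by linarith) hzR _ ?_
      obtain ⟨h1, h2⟩ := hneg z hz h k
      have h3 := hsum (-z.re) (by linarith)
      rw [← h1.tsum_eq]
      refine tsum_of_norm_bounded h3 fun n => ?_
      simpa using h2 n 2 (hF2 k _)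
    · simp [h]; positivity
    · rw [abs_of_pos h] at hzR ⊢
      refine hbound _ h hzR _ ?_
      obtain ⟨h1, h2⟩ := hpos z hz h k
      rw [← h1.tsum_eq]
      exact tsum_of_norm_bounded (hsum _ h) fun n => h2 n 2 (hF2 k _)
  · intro x hx hxR
    have hz : (-x : ℂ) ∈ ball (0 : ℂ) R := by simpa [abs_of_pos hx] using hxR
    have hre : (-x : ℂ).re < 0 := by simpa using hx
    have h1 := fun k => hneg _ hz hre k
    have h2 := tendsto_tsum_of_dominated_convergence (𝓕 := atTop)
      (f := fun k n => cocycle U w n s * check (F k) ((boundaryHomeo U)^[n] s) /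
        μ (-x) ^ (n + 1))
      -- Only the term at `s` itself survives, since `φ^n(s) ≠ s` for `n ≥ 1`.
      (g := fun n => if n = 0 then (μ (-x))⁻¹ else 0) (hsum x hx).summable ?_
      (.of_forall fun k n => by simpa using (h1 k).2 n 2 (hF2 k _))
    · simp_rw [fun k => (h1 k).1.tsum_eq, tsum_ite_eq] at h2
      convert h2 using 2
      simp [hμ, Complex.exp_neg, mul_comm]
    · rintro (_ | n)
      · simpa [cocycle_zero] using hFs.div_const (μ (-x))
      · simpa using ((hF0 _ (hforw n)).const_mul _).div_const _
  · intro x hx hxR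
    have hz : (x : ℂ) ∈ ball (0 : ℂ) R := by simpa [abs_of_pos hx] using hxR
    have h1 := fun k => hpos _ hz (by simpa using hx) k
    have h2 := tendsto_tsum_of_dominated_convergence (𝓕 := atTop)
      (f := fun k n => -(μ x ^ n * check (F k) ((boundaryHomeo U).symm^[n + 1] s) /
        cocycle U w (n + 1) ((boundaryHomeo U).symm^[n + 1] s)))
      (g := fun _ => 0) (hsum x hx).summable ?_
      (.of_forall fun k n => by simpa using (h1 k).2 n 2 (hF2 k _))
    · simp_rw [fun k => (h1 k).1.tsum_eq, tsum_zero] at h2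
      exact h2
    · intro n
      simpa using (((hF0 _ (hback n)).const_mul (μ x ^ n)).div_const
        (cocycle U w (n + 1) ((boundaryHomeo U).symm^[n + 1] s))).neg

/-- If `T` had a right inverse, `1` would be a multiple of `w`, which the character `s` annihilates.
-/
theorem zero_mem_spectrum_weightedOperator (hA : Ring.jacobson A = ⊥) {s : shilovBoundary A}
    (hw : check w s = 0) : (0 : ℂ) ∈ spectrum ℂ (weightedOperator hA U w) := by
  rw [spectrum.zero_mem_iff]
  intro hu
  obtain ⟨S, hS⟩ := hu.exists_right_inv
  have h1 : w * U (S 1) = 1 := congrArg (fun S : A →L[ℂ] A => S 1) hS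
  have h2 := congrArg (s : characterSpace ℂ A) h1
  rw [check_eq] at hw
  simp [hw] at h2

end

end WeightedAut

theorem proposition1 {A : Type*} [NormedCommRing A] [NormedAlgebra ℂ A] [CompleteSpace A]
    (hA : Ring.jacobson A = ⊥) (U : A ≃ₐ[ℂ] A) (w : A)
    (hpeak : ∀ t : WeightedAut.shilovBoundary A,
      WeightedAut.IsPeakPoint (WeightedAut.checkAlgebra A) t)
    (lam : ℂ) (s : WeightedAut.shilovBoundary A)
    (hs : s ∉ Function.periodicPts (WeightedAut.boundaryHomeo U))
    (hle : ∀ n : ℕ, ‖WeightedAut.cocycle U w n s‖ ≤ ‖lam‖ ^ n)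
    (hge : ∀ n : ℕ,
      ‖lam‖ ^ n ≤ ‖WeightedAut.cocycle U w n ((WeightedAut.boundaryHomeo U).symm^[n] s)‖) :
    lam • Metric.sphere (0 : ℂ) 1 ⊆ spectrum ℂ (WeightedAut.weightedOperator hA U w) := by
  rintro _ ⟨ζ, hζ, rfl⟩
  have hζ1 : ‖ζ‖ = 1 := by simpa using hζ
  rcases eq_or_ne lam 0 with rfl | hlam
  · have h1 := hle 1
    simp only [smul_eq_mul, zero_mul]
    exact WeightedAut.zero_mem_spectrum_weightedOperator hA (s := s)
      (by simpa [WeightedAut.cocycle] using h1)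
  · have hζ0 : ζ ≠ 0 := by rintro rfl; simp at hζ1
    have hn : ‖lam • ζ‖ = ‖lam‖ := by simp [hζ1]
    exact WeightedAut.mem_spectrum_weightedOperator hA (hpeak s) hs (mul_ne_zero hlam hζ0)
      (by simpa only [hn] using hle) (by simpa only [hn] using hge)
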